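/- Let $H$ be a complex Hilbert space and let $T\in\mathcal B(H)$ be a bounded linear operator. A bounded operator $S$ on $H$ is called absolutely minimum attaining (AM) if for every nonzero closed subspace $M\subseteq H$ there is a unit vector $x\in M$ with $\|Sx\|=\inf\{\|Sy\| : y\in M,\ \|y\|=1\}$. For a bounded self-adjoint operator $A$ on $H$, let $\sigma_{ess}(A)=\sigma(A)\setminus\sigma_d(A)$, where $\sigma_d(A)$ is the set of eigenvalues of $A$ of finite multiplicity that are isolated points of $\sigma(A)$. Suppose that $\sigma_{ess}(T^*T)=\sigma_{ess}(TT^*)$. Then: 1. $TT^*$ is AM if and only if $T^*T$ is AM. 2. $T$ is AM if and only if $T^*$ is AM. -/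

import Mathlib

section AMOperators

variable {E F : Type*} [NormedAddCommGroup E] [InnerProductSpace ℂ E]
  [NormedAddCommGroup F] [InnerProductSpace ℂ F]

/-- The minimum modulus `m(T) = inf {‖T x‖ : ‖x‖ = 1}`. -/
noncomputable def minimumModulus (T : E →L[ℂ] F) : ℝ :=
  sInf {r : ℝ | ∃ x : E, ‖x‖ = 1 ∧ r = ‖T x‖}

/-- `T` is minimum attaining if some unit vector `x` satisfies `‖T x‖ = m(T)`. -/
def IsMinimumAttaining (T : E →L[ℂ] F) : Prop :=
  ∃ x : E, ‖x‖ = 1 ∧ ‖T x‖ = minimumModulus T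

/-- `T` is absolutely minimum attaining (an AM-operator) if its restriction to every nonzero
closed subspace `M` is minimum attaining. (The zero subspace has no unit vectors.) -/
def IsAbsolutelyMinimumAttaining (T : E →L[ℂ] F) : Prop :=
  ∀ M : Submodule ℂ E, IsClosed (M : Set E) → M ≠ ⊥ → IsMinimumAttaining (T ∘L M.subtypeL)

/-- The discrete spectrum of a (self-adjoint) bounded operator: the eigenvalues of finite
multiplicity that are isolated points of the spectrum. -/
def discreteSpectrum (A : E →L[ℂ] E) : Set ℂ :=
  {z : ℂ | z ∈ spectrum ℂ A ∧ ¬ AccPt z (Filter.principal (spectrum ℂ A)) ∧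
    Module.End.HasEigenvalue (A : E →ₗ[ℂ] E) z ∧
    FiniteDimensional ℂ (Module.End.eigenspace (A : E →ₗ[ℂ] E) z)}

/-- The essential spectrum of a (self-adjoint) bounded operator: the complement of the discrete
spectrum in the spectrum. -/
def essentialSpectrum (A : E →L[ℂ] E) : Set ℂ :=
  spectrum ℂ A \ discreteSpectrum A

end AMOperators

/-! Being AM is a statement about the spectrum of `|B|` modulo finite dimensions. An operator is AM
exactly when some `β ≥ 0` satisfies `‖B x‖ ≤ β ‖x‖` on a subspace of finite codimension and, for
each `b < β`, `b ‖x‖ ≤ ‖B x‖` on another such subspace (`HasAlmostModulus`). Spectrally, `|B|` has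
at most the point `β` as essential spectrum and only finitely many eigenvalues above it, with
multiplicity.

This condition passes between `B` and `B*B` with `β` replaced by `β²`, so both claims reduce to
passing from `T` to `T*`. The upper bound always transfers. A positive lower bound transfers once
`ker T*` is finite-dimensional, and only here do the essential spectra enter: the lower bound keeps
`0` out of that of `T*T`, hence out of that of `TT*`, whose kernel is `ker T*`. -/

open ContinuousLinearMap Filter Topology

/-! ### Bounds up to finite codimension -/

section AlmostBounds

variable {E F : Type*} [NormedAddCommGroup E] [InnerProductSpace ℂ E]
  [NormedAddCommGroup F] [InnerProductSpace ℂ F]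

/-- `‖B x‖ ≤ b ‖x‖` on the orthogonal complement of a finite-dimensional subspace. -/
def AlmostLE (B : E →L[ℂ] F) (b : ℝ) : Prop :=
  ∃ W : Submodule ℂ E, FiniteDimensional ℂ W ∧ ∀ x ∈ Wᗮ, ‖B x‖ ≤ b * ‖x‖

/-- `b ‖x‖ ≤ ‖B x‖` on the orthogonal complement of a finite-dimensional subspace. -/
def AlmostGE (B : E →L[ℂ] F) (b : ℝ) : Prop :=
  ∃ W : Submodule ℂ E, FiniteDimensional ℂ W ∧ ∀ x ∈ Wᗮ, b * ‖x‖ ≤ ‖B x‖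

/-- The lower bounds of `B` up to finite codimension reach an upper bound of the same kind. -/
def HasAlmostModulus (B : E →L[ℂ] F) : Prop :=
  ∃ β : ℝ, 0 ≤ β ∧ AlmostLE B β ∧ ∀ b < β, AlmostGE B b

theorem almostGE_of_nonpos (B : E →L[ℂ] F) {b : ℝ} (hb : b ≤ 0) : AlmostGE B b :=
  ⟨⊥, inferInstance, fun x _ =>
    (mul_nonpos_of_nonpos_of_nonneg hb (norm_nonneg x)).trans (norm_nonneg _)⟩

theorem AlmostGE.mono {B : E →L[ℂ] F} {b c : ℝ} (h : AlmostGE B c) (hbc : b ≤ c) :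
    AlmostGE B b := by
  obtain ⟨W, hW, h⟩ := h
  exact ⟨W, hW, fun x hx => (mul_le_mul_of_nonneg_right hbc (norm_nonneg x)).trans (h x hx)⟩

theorem finiteDimensional_of_inf_orthogonal_eq_bot (W K : Submodule ℂ E) [FiniteDimensional ℂ W]
    (h : ∀ x ∈ K, x ∈ Wᗮ → x = 0) : FiniteDimensional ℂ K := by
  refine FiniteDimensional.of_injective
    ((W.orthogonalProjectionOnto : E →L[ℂ] W).toLinearMap.comp K.subtype) ?_
  rw [← LinearMap.ker_eq_bot, LinearMap.ker_eq_bot']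
  intro x hx
  have hx' : W.orthogonalProjectionOnto (x : E) = 0 := hx
  exact Subtype.ext (h x x.2 (Submodule.orthogonalProjectionOnto_eq_zero_iff.1 hx'))

theorem AlmostGE.finiteDimensional_ker {B : E →L[ℂ] F} {b : ℝ} (hb : 0 < b)
    (h : AlmostGE B b) : FiniteDimensional ℂ B.ker := by
  obtain ⟨W, hW, h⟩ := h
  refine finiteDimensional_of_inf_orthogonal_eq_bot W _ fun x hx hxW => ?_
  have h1 := h x hxW
  have h2 : B x = 0 := hx
  rw [h2, norm_zero] at h1
  exact norm_le_zero_iff.1 (by nlinarith [norm_nonneg x])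

/-- Compactness: for unit vectors orthogonal to the kernel with `B x n → 0`, the components in `W`
converge along a subsequence, and the lower bound makes the remaining components Cauchy. The limit
is a unit vector in both the kernel and its orthogonal complement. -/
theorem AlmostGE.exists_bound_on_orthogonal_ker [CompleteSpace E] {B : E →L[ℂ] F} {b : ℝ}
    (hb : 0 < b) (h : AlmostGE B b) : ∃ c > 0, ∀ x ∈ B.kerᗮ, c * ‖x‖ ≤ ‖B x‖ := by
  obtain ⟨W, hW, h⟩ := h
  by_contra! hc
  have hseq : ∀ n : ℕ, ∃ x ∈ B.kerᗮ, ‖x‖ = 1 ∧ ‖B x‖ < 1 / ((n : ℝ) + 1) := by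
    intro n
    obtain ⟨x, hx, hlt⟩ := hc (1 / ((n : ℝ) + 1)) (by positivity)
    have hx0 : 0 < ‖x‖ := by
      by_contra hn
      have : x = 0 := norm_le_zero_iff.1 (not_lt.1 hn)
      simp [this] at hlt
    refine ⟨(‖x‖⁻¹ : ℂ) • x, Submodule.smul_mem _ _ hx, ?_, ?_⟩
    · simp [norm_smul, hx0.ne']
    · rw [map_smul, norm_smul]
      simp only [norm_inv, Complex.norm_real, norm_norm]
      rw [inv_mul_lt_iff₀ hx0, mul_comm]
      exact hlt
  choose x hxK hx1 hxB using hseq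
  have hBx : Tendsto (fun n => B (x n)) atTop (𝓝 0) :=
    squeeze_zero_norm (fun n => (hxB n).le) tendsto_one_div_add_atTop_nhds_zero_nat
  have hmem : ∀ n, W.orthogonalProjectionOnto (x n) ∈ Metric.closedBall (0 : W) 1 := by
    intro n
    rw [mem_closedBall_zero_iff, ← hx1 n]
    exact W.norm_orthogonalProjectionOnto_apply_le (x n)
  have : ProperSpace W := FiniteDimensional.proper ℂ W
  obtain ⟨u, -, φ, hφ, hu⟩ := (isCompact_closedBall (0 : W) 1).tendsto_subseq hmem
  have hu' : Tendsto (fun n => ((W.orthogonalProjectionOnto (x (φ n)) : W) : E)) atTop (𝓝 (u : E)) :=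
    (continuous_subtype_val.tendsto u).comp hu
  set v : ℕ → E := fun n => x (φ n) - W.orthogonalProjectionOnto (x (φ n)) with hv
  have hvW : ∀ n, v n ∈ Wᗮ := fun n => W.sub_starProjection_mem_orthogonal (x (φ n))
  have hBv : Tendsto (fun n => B (v n)) atTop (𝓝 (0 - B u)) := by
    simp only [hv, map_sub]
    exact (hBx.comp hφ.tendsto_atTop).sub ((B.continuous.tendsto _).comp hu')
  have hvC : CauchySeq v := by
    have hC := hBv.cauchySeq
    rw [Metric.cauchySeq_iff] at hC ⊢
    intro ε hε
    obtain ⟨N, hN⟩ := hC (b * ε) (by positivity)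
    refine ⟨N, fun m hm n hn => ?_⟩
    have h1 := hN m hm n hn
    rw [dist_eq_norm, ← map_sub] at h1
    have h2 := h _ (Submodule.sub_mem _ (hvW m) (hvW n))
    rw [dist_eq_norm]
    exact lt_of_mul_lt_mul_left (h2.trans_lt h1) hb.le
  obtain ⟨w, hw⟩ := cauchySeq_tendsto_of_complete hvC
  have hx : Tendsto (fun n => x (φ n)) atTop (𝓝 (w + u)) := by
    have := hw.add hu'
    simpa [hv] using this
  have hnorm : ‖w + u‖ = 1 :=
    tendsto_nhds_unique hx.norm (by simp [hx1])
  have hK : w + u ∈ B.kerᗮ :=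
    (Submodule.isClosed_orthogonal _).mem_of_tendsto hx (Eventually.of_forall fun n => hxK _)
  have hker : w + u ∈ B.ker :=
    tendsto_nhds_unique ((B.continuous.tendsto _).comp hx) (hBx.comp hφ.tendsto_atTop)
  have := Submodule.inner_right_of_mem_orthogonal hker hK
  rw [inner_self_eq_zero] at this
  simp [this] at hnorm

/-! ### Transfer to `B*` and `B*B` -/

variable [CompleteSpace E] [CompleteSpace F]

theorem norm_apply_sq_le_norm_adjoint_mul (B : E →L[ℂ] F) (x : E) :
    ‖B x‖ ^ 2 ≤ ‖adjoint B (B x)‖ * ‖x‖ := by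
  rw [apply_norm_sq_eq_inner_adjoint_left]
  exact re_inner_le_norm _ _

theorem AlmostLE.adjoint {B : E →L[ℂ] F} {b : ℝ} (hb : 0 ≤ b) (h : AlmostLE B b) :
    AlmostLE (adjoint B) b := by
  obtain ⟨W, hW, h⟩ := h
  refine ⟨W.map B.toLinearMap, inferInstance, fun y hy => ?_⟩
  have hmem : ContinuousLinearMap.adjoint B y ∈ Wᗮ := by
    rw [Submodule.mem_orthogonal] at hy ⊢
    intro u hu
    rw [adjoint_inner_right]
    exact hy _ (Submodule.mem_map_of_mem hu)
  have h1 := h _ hmem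
  have h2 := norm_apply_sq_le_norm_adjoint_mul (ContinuousLinearMap.adjoint B) y
  rw [adjoint_adjoint] at h2
  rcases (norm_nonneg (ContinuousLinearMap.adjoint B y)).eq_or_lt with h0 | h0
  · rw [← h0]; positivity
  · nlinarith [norm_nonneg y]

/-- The image of `Wᗮ` is closed because `B` is bounded below there, and its orthogonal complement is
the preimage of `W` under `B*`, finite-dimensional because `W` and `ker B*` are. -/
theorem AlmostGE.exists_orthogonal_le_image {B : E →L[ℂ] F} {b : ℝ} (hb : 0 < b)
    {W : Submodule ℂ E} [FiniteDimensional ℂ W] (h : ∀ x ∈ Wᗮ, b * ‖x‖ ≤ ‖B x‖)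
    [FiniteDimensional ℂ (adjoint B).ker] :
    ∃ W' : Submodule ℂ F, FiniteDimensional ℂ W' ∧ ∀ y ∈ W'ᗮ, ∃ x ∈ Wᗮ, B x = y := by
  set R : Submodule ℂ F := Wᗮ.map B.toLinearMap with hR
  have hclosed : IsClosed (R : Set F) := by
    have hanti : AntilipschitzWith (Real.toNNReal b⁻¹) (B ∘L (Wᗮ).subtypeL) := by
      refine AddMonoidHomClass.antilipschitz_of_bound _ fun x => ?_
      rw [Real.coe_toNNReal _ (by positivity), le_inv_mul_iff₀ hb]
      exact h x x.2
    have := hanti.isClosed_range (B ∘L (Wᗮ).subtypeL).uniformContinuous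
    convert this using 1
    ext y
    simp [hR]
  have hRorth : ∀ y, y ∈ Rᗮ ↔ adjoint B y ∈ W := by
    intro y
    rw [← W.orthogonal_orthogonal, Submodule.mem_orthogonal, Submodule.mem_orthogonal]
    constructor
    · intro hy u hu
      rw [adjoint_inner_right]
      exact hy _ (Submodule.mem_map_of_mem hu)
    · rintro hy _ ⟨u, hu, rfl⟩
      have := hy u hu
      rwa [adjoint_inner_right] at this
  refine ⟨Rᗮ, ?_, fun y hy => ?_⟩
  · have : Rᗮ = W.comap (adjoint B).toLinearMap := by
      ext y; exact hRorth y
    rw [this]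
    infer_instance
  · have : CompleteSpace R := hclosed.completeSpace_coe
    rw [R.orthogonal_orthogonal] at hy
    obtain ⟨x, hx, rfl⟩ := hy
    exact ⟨x, hx, rfl⟩

theorem AlmostGE.adjoint {B : E →L[ℂ] F} {b : ℝ} (hb : 0 < b) (h : AlmostGE B b)
    [FiniteDimensional ℂ (adjoint B).ker] : AlmostGE (adjoint B) b := by
  obtain ⟨W, hW, h⟩ := h
  obtain ⟨W', hW', h'⟩ := AlmostGE.exists_orthogonal_le_image hb h
  refine ⟨W', hW', fun y hy => ?_⟩
  obtain ⟨x, hx, rfl⟩ := h' y hy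
  have h1 := h x hx
  have h2 := norm_apply_sq_le_norm_adjoint_mul B x
  rcases (norm_nonneg x).eq_or_lt with h0 | h0
  · have : x = 0 := norm_eq_zero.1 h0.symm
    simp [this]
  · nlinarith [norm_nonneg (B x)]

theorem AlmostLE.adjoint_comp_self {B : E →L[ℂ] F} {b : ℝ} (hb : 0 ≤ b) (h : AlmostLE B b) :
    AlmostLE (ContinuousLinearMap.adjoint B ∘L B) (b ^ 2) := by
  obtain ⟨V, hV, h'⟩ := h.adjoint hb
  obtain ⟨W, hW, h⟩ := h
  refine ⟨W ⊔ V.map (ContinuousLinearMap.adjoint B).toLinearMap, inferInstance, fun x hx => ?_⟩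
  have hxW : x ∈ Wᗮ := Submodule.orthogonal_le le_sup_left hx
  have hBx : B x ∈ Vᗮ := by
    rw [Submodule.mem_orthogonal]
    intro v hv
    rw [← adjoint_inner_left]
    exact (Submodule.mem_orthogonal _ _).1 (Submodule.orthogonal_le le_sup_right hx) _
      (Submodule.mem_map_of_mem hv)
  calc ‖ContinuousLinearMap.adjoint B (B x)‖ ≤ b * ‖B x‖ := h' _ hBx
    _ ≤ b * (b * ‖x‖) := mul_le_mul_of_nonneg_left (h x hxW) hb
    _ = b ^ 2 * ‖x‖ := by ring

theorem AlmostLE.of_adjoint_comp_self {B : E →L[ℂ] F} {b : ℝ} (hb : 0 ≤ b)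
    (h : AlmostLE (ContinuousLinearMap.adjoint B ∘L B) (b ^ 2)) : AlmostLE B b := by
  obtain ⟨W, hW, h⟩ := h
  refine ⟨W, hW, fun x hx => ?_⟩
  have h1 : ‖ContinuousLinearMap.adjoint B (B x)‖ ≤ b ^ 2 * ‖x‖ := h x hx
  have h2 := norm_apply_sq_le_norm_adjoint_mul B x
  refine abs_le_of_sq_le_sq' ?_ (by positivity) |>.2
  nlinarith [norm_nonneg x]

theorem AlmostGE.adjoint_comp_self {B : E →L[ℂ] F} {b : ℝ} (hb : 0 ≤ b) (h : AlmostGE B b) :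
    AlmostGE (ContinuousLinearMap.adjoint B ∘L B) (b ^ 2) := by
  obtain ⟨W, hW, h⟩ := h
  refine ⟨W, hW, fun x hx => ?_⟩
  have h1 := h x hx
  have h2 := norm_apply_sq_le_norm_adjoint_mul B x
  change b ^ 2 * ‖x‖ ≤ ‖ContinuousLinearMap.adjoint B (B x)‖
  rcases (norm_nonneg x).eq_or_lt with h0 | h0
  · rw [← h0, mul_zero]; positivity
  · have h3 : (b * ‖x‖) ^ 2 ≤ ‖B x‖ ^ 2 := pow_le_pow_left₀ (by positivity) h1 2
    refine le_of_mul_le_mul_right ?_ h0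
    nlinarith

/-- Since `Wᗮ` need not be invariant under `A = B*B`, the bound is proved on vectors `A u` with `u ∈
Wᗮ`, which fill a subspace of finite codimension. There `‖A u‖² ≤ ‖B A u‖ ‖B u‖` and `b ‖B u‖ ≤ ‖A
u‖`. -/
theorem AlmostGE.of_adjoint_comp_self {B : E →L[ℂ] F} {b : ℝ} (hb : 0 < b)
    (h : AlmostGE (ContinuousLinearMap.adjoint B ∘L B) (b ^ 2)) : AlmostGE B b := by
  have hsa : ContinuousLinearMap.adjoint (ContinuousLinearMap.adjoint B ∘L B) =
      ContinuousLinearMap.adjoint B ∘L B := by simp [adjoint_comp]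
  have hker : FiniteDimensional ℂ
      (ContinuousLinearMap.adjoint (ContinuousLinearMap.adjoint B ∘L B)).ker := by
    rw [hsa]; exact h.finiteDimensional_ker (by positivity)
  obtain ⟨W, hW, h⟩ := h
  obtain ⟨W', hW', h'⟩ := AlmostGE.exists_orthogonal_le_image (by positivity) h
  refine ⟨W', hW', fun y hy => ?_⟩
  obtain ⟨u, hu, rfl⟩ := h' y hy
  have h0 := h u hu
  set A := ContinuousLinearMap.adjoint B ∘L B with hA
  -- `‖A u‖² = ⟪A² u, u⟫ = ⟪B A u, B u⟫`
  have h1 : ‖A u‖ ^ 2 ≤ ‖B (A u)‖ * ‖B u‖ := by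
    have : ‖A u‖ ^ 2 = RCLike.re (inner ℂ (B (A u)) (B u)) := by
      rw [← adjoint_inner_right, ← inner_self_eq_norm_sq (𝕜 := ℂ)]
      rfl
    rw [this]
    exact re_inner_le_norm _ _
  have h2 : ‖B u‖ ^ 2 ≤ ‖A u‖ * ‖u‖ := norm_apply_sq_le_norm_adjoint_mul B u
  have h3 : (b * ‖B u‖) ^ 2 ≤ ‖A u‖ ^ 2 := by nlinarith [norm_nonneg (A u)]
  have h4 : b * ‖B u‖ ≤ ‖A u‖ := abs_le_of_sq_le_sq' h3 (norm_nonneg _) |>.2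
  rcases (norm_nonneg (A u)).eq_or_lt with h5 | h5
  · rw [← h5, mul_zero]; exact norm_nonneg _
  · refine le_of_mul_le_mul_right ?_ h5
    nlinarith [norm_nonneg (B (A u))]

theorem hasAlmostModulus_adjoint_comp_self_iff (B : E →L[ℂ] F) :
    HasAlmostModulus (ContinuousLinearMap.adjoint B ∘L B) ↔ HasAlmostModulus B := by
  constructor
  · rintro ⟨γ, hγ, hle, hge⟩
    refine ⟨√γ, Real.sqrt_nonneg _,
      AlmostLE.of_adjoint_comp_self (Real.sqrt_nonneg _) (by rwa [Real.sq_sqrt hγ]), fun b hb => ?_⟩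
    rcases le_or_gt b 0 with h0 | h0
    · exact almostGE_of_nonpos B h0
    · exact AlmostGE.of_adjoint_comp_self h0 (hge _ ((Real.lt_sqrt h0.le).1 hb))
  · rintro ⟨β, hβ, hle, hge⟩
    refine ⟨β ^ 2, by positivity, hle.adjoint_comp_self hβ, fun c hc => ?_⟩
    rcases le_or_gt c 0 with h0 | h0
    · exact almostGE_of_nonpos _ h0
    · have := (hge (√c) ((Real.sqrt_lt' (hβ.lt_of_ne ?_)).2 hc)).adjoint_comp_self
        (Real.sqrt_nonneg c)
      · rwa [Real.sq_sqrt h0.le] at this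
      · rintro rfl
        norm_num at hc
        linarith

theorem isUnit_of_norm_le_of_adjoint_injective {A : E →L[ℂ] E} {c : ℝ} (hc : 0 < c)
    (h : ∀ x, c * ‖x‖ ≤ ‖A x‖) (hA : ∀ x, ContinuousLinearMap.adjoint A x = 0 → x = 0) :
    IsUnit A := by
  rw [isUnit_iff_bijective, bijective_iff_dense_range_and_antilipschitz]
  refine ⟨?_, Real.toNNReal c⁻¹, AddMonoidHomClass.antilipschitz_of_bound _ fun x => ?_⟩
  · rw [Submodule.topologicalClosure_eq_top_iff, orthogonal_range, LinearMap.ker_eq_bot']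
    exact hA
  · rw [Real.coe_toNNReal _ (by positivity), le_inv_mul_iff₀ hc]
    exact h x

/-- A self-adjoint `A` preserves `ker A` and its complement: `A - z` is `-z` on the former and
bounded below by `c - ‖z‖` on the latter. -/
theorem exists_norm_sub_smul_ge {A : E →L[ℂ] E} (hA : ContinuousLinearMap.adjoint A = A) {c : ℝ}
    (h : ∀ x ∈ A.kerᗮ, c * ‖x‖ ≤ ‖A x‖) {z : ℂ} (hz : z ≠ 0) (hzc : ‖z‖ < c) :
    ∃ d > 0, ∀ x, d * ‖x‖ ≤ ‖A x - z • x‖ := by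
  have hz0 : 0 < ‖z‖ := norm_pos_iff.2 hz
  refine ⟨min (c - ‖z‖) ‖z‖, lt_min (sub_pos.2 hzc) hz0, fun x => ?_⟩
  set d := min (c - ‖z‖) ‖z‖ with hd
  have hd0 : 0 ≤ d := (lt_min (sub_pos.2 hzc) hz0).le
  have hcl : IsClosed (A.ker : Set E) := A.isClosed_ker
  have : CompleteSpace A.ker := hcl.completeSpace_coe
  obtain ⟨k, hk, p, hp, rfl⟩ := A.ker.exists_add_mem_mem_orthogonal x
  have hAk : A k = 0 := hk
  have hkp : inner ℂ k p = 0 := Submodule.inner_right_of_mem_orthogonal hk hp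
  have hAp : A p - z • p ∈ A.kerᗮ := by
    refine Submodule.sub_mem _ ?_ (Submodule.smul_mem _ _ hp)
    rw [Submodule.mem_orthogonal]
    intro u hu
    have hu : A u = 0 := hu
    rw [← adjoint_inner_left, hA, hu, inner_zero_left]
  have heq : A (k + p) - z • (k + p) = (-z) • k + (A p - z • p) := by
    rw [map_add, hAk]; module
  have h1 : ‖k + p‖ * ‖k + p‖ = ‖k‖ * ‖k‖ + ‖p‖ * ‖p‖ :=
    norm_add_sq_eq_norm_sq_add_norm_sq_of_inner_eq_zero _ _ hkp
  have h2 := norm_add_sq_eq_norm_sq_add_norm_sq_of_inner_eq_zero ((-z) • k) (A p - z • p)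
    (Submodule.inner_right_of_mem_orthogonal (Submodule.smul_mem A.ker _ hk) hAp)
  rw [heq]
  have h3 : d * ‖p‖ ≤ ‖A p - z • p‖ := by
    have h4 := norm_sub_norm_le (A p) (z • p)
    rw [norm_smul] at h4
    have h5 := h p hp
    have h6 : d * ‖p‖ ≤ (c - ‖z‖) * ‖p‖ :=
      mul_le_mul_of_nonneg_right (min_le_left _ _) (norm_nonneg p)
    linarith
  have h4 : d * ‖k‖ ≤ ‖(-z) • k‖ := by
    rw [norm_smul, norm_neg]
    exact mul_le_mul_of_nonneg_right (min_le_right _ _) (norm_nonneg k)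
  refine abs_le_of_sq_le_sq' ?_ (norm_nonneg _) |>.2
  have h5 := pow_le_pow_left₀ (by positivity) h3 2
  have h6 := pow_le_pow_left₀ (by positivity) h4 2
  have h7 : (d * ‖k + p‖) ^ 2 = (d * ‖p‖) ^ 2 + (d * ‖k‖) ^ 2 := by
    rw [mul_pow, pow_two ‖k + p‖, h1]; ring
  rw [h7, pow_two ‖(-z) • k + _‖, h2]
  linarith

end AlmostBounds

/-! ### Zero and the essential spectrum -/

section EssentialSpectrum

variable {E F : Type*} [NormedAddCommGroup E] [InnerProductSpace ℂ E]
  [NormedAddCommGroup F] [InnerProductSpace ℂ F]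
variable [CompleteSpace E] [CompleteSpace F]

theorem AlmostGE.zero_notMem_essentialSpectrum {A : E →L[ℂ] E}
    (hA : ContinuousLinearMap.adjoint A = A) {b : ℝ} (hb : 0 < b) (h : AlmostGE A b) :
    (0 : ℂ) ∉ essentialSpectrum A := by
  rintro ⟨h0, hd⟩
  have hfin := h.finiteDimensional_ker hb
  obtain ⟨c, hc, hbound⟩ := h.exists_bound_on_orthogonal_ker hb
  refine hd ⟨h0, ?_, ?_, ?_⟩
  · rw [accPt_iff_nhds]
    intro hacc
    obtain ⟨z, ⟨hz, hzs⟩, hz0⟩ := hacc _ (Metric.ball_mem_nhds 0 hc)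
    rw [mem_ball_zero_iff] at hz
    obtain ⟨d, hd, hdb⟩ := exists_norm_sub_smul_ge hA hbound hz0 hz
    -- The adjoint of `A - z` is `A - conj z`, so its injectivity needs the bound at the conjugate.
    obtain ⟨d', hd', hdb'⟩ := exists_norm_sub_smul_ge hA hbound
      (z := starRingEnd ℂ z) (by simpa using hz0) (by simpa using hz)
    refine hzs ?_
    have hneg : algebraMap ℂ (E →L[ℂ] E) z - A = -(A - z • 1) := by
      rw [Algebra.algebraMap_eq_smul_one]; abel
    change IsUnit (algebraMap ℂ (E →L[ℂ] E) z - A)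
    rw [hneg, IsUnit.neg_iff]
    refine isUnit_of_norm_le_of_adjoint_injective hd (fun x => by simpa using hdb x) fun x hx => ?_
    have h1 : A x - starRingEnd ℂ z • x = 0 := by
      rw [← hx, map_sub, hA, map_smulₛₗ]
      simp [← star_eq_adjoint]
    have h2 := hdb' x
    rw [h1, norm_zero] at h2
    exact norm_le_zero_iff.1 (by nlinarith [norm_nonneg x])
  · rw [Module.End.hasEigenvalue_iff, Module.End.eigenspace_zero]
    intro hker
    rw [spectrum.zero_mem_iff] at h0
    refine h0 (isUnit_of_norm_le_of_adjoint_injective hc (fun x => hbound x ?_) fun x hx => ?_)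
    · have : A.ker = ⊥ := hker
      rw [this]; simp
    · rw [hA] at hx
      exact LinearMap.ker_eq_bot'.1 hker x hx
  · rw [Module.End.eigenspace_zero]
    exact hfin

theorem finiteDimensional_ker_of_zero_notMem_essentialSpectrum {A : E →L[ℂ] E}
    (h : (0 : ℂ) ∉ essentialSpectrum A) : FiniteDimensional ℂ A.ker := by
  by_cases h0 : (0 : ℂ) ∈ spectrum ℂ A
  · have hd : (0 : ℂ) ∈ discreteSpectrum A := by
      by_contra hd
      exact h ⟨h0, hd⟩
    have := hd.2.2.2
    rwa [Module.End.eigenspace_zero] at this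
  · rw [spectrum.zero_notMem_iff, isUnit_iff_bijective] at h0
    have : A.ker = ⊥ := LinearMap.ker_eq_bot.2 h0.1
    rw [this]
    infer_instance

theorem HasAlmostModulus.adjoint {T : E →L[ℂ] F} (h : HasAlmostModulus T)
    (hess : (0 : ℂ) ∈ essentialSpectrum (T ∘L ContinuousLinearMap.adjoint T) →
      (0 : ℂ) ∈ essentialSpectrum (ContinuousLinearMap.adjoint T ∘L T)) :
    HasAlmostModulus (ContinuousLinearMap.adjoint T) := by
  obtain ⟨β, hβ, hle, hge⟩ := h
  refine ⟨β, hβ, hle.adjoint hβ, fun b hb => ?_⟩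
  rcases le_or_gt b 0 with h0 | h0
  · exact almostGE_of_nonpos _ h0
  have hT := hge b hb
  have hsa : ContinuousLinearMap.adjoint (ContinuousLinearMap.adjoint T ∘L T) =
      ContinuousLinearMap.adjoint T ∘L T := by simp [adjoint_comp]
  have hnot := (hT.adjoint_comp_self h0.le).zero_notMem_essentialSpectrum hsa (by positivity)
  have hker := finiteDimensional_ker_of_zero_notMem_essentialSpectrum (mt hess hnot)
  rw [ker_self_comp_adjoint] at hker
  exact hT.adjoint h0

end EssentialSpectrum

/-! ### Almost modulus implies AM -/

section MinimumAttaining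

variable {E F : Type*} [NormedAddCommGroup E] [InnerProductSpace ℂ E]
  [NormedAddCommGroup F] [InnerProductSpace ℂ F]

theorem minimumModulus_le (B : E →L[ℂ] F) {x : E} (hx : ‖x‖ = 1) :
    minimumModulus B ≤ ‖B x‖ :=
  csInf_le ⟨0, by rintro _ ⟨y, -, rfl⟩; exact norm_nonneg _⟩ ⟨x, hx, rfl⟩

theorem minimumModulus_nonneg (B : E →L[ℂ] F) : 0 ≤ minimumModulus B :=
  Real.sInf_nonneg (by rintro _ ⟨y, -, rfl⟩; exact norm_nonneg _)

theorem minimumModulus_mul_norm_le (B : E →L[ℂ] F) (x : E) :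
    minimumModulus B * ‖x‖ ≤ ‖B x‖ := by
  rcases (norm_nonneg x).eq_or_lt with h0 | h0
  · rw [← h0, mul_zero]; exact norm_nonneg _
  · have h1 := minimumModulus_le B (x := (‖x‖⁻¹ : ℂ) • x) (by simp [norm_smul, h0.ne'])
    rw [map_smul, norm_smul] at h1
    simp only [norm_inv, Complex.norm_real, norm_norm] at h1
    rwa [le_inv_mul_iff₀ h0, mul_comm] at h1

theorem le_minimumModulus [Nontrivial E] (B : E →L[ℂ] F) {c : ℝ}
    (h : ∀ x, c * ‖x‖ ≤ ‖B x‖) : c ≤ minimumModulus B := by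
  obtain ⟨x, hx⟩ := exists_norm_eq E zero_le_one
  refine le_csInf ⟨_, x, hx, rfl⟩ ?_
  rintro _ ⟨y, hy, rfl⟩
  simpa [hy] using h y

theorem isMinimumAttaining_of_norm_le (B : E →L[ℂ] F) {x : E} (hx0 : x ≠ 0)
    (hx : ‖B x‖ ≤ minimumModulus B * ‖x‖) : IsMinimumAttaining B := by
  have h0 : 0 < ‖x‖ := norm_pos_iff.2 hx0
  have h1 : ‖(‖x‖⁻¹ : ℂ) • x‖ = 1 := by simp [norm_smul, h0.ne']
  refine ⟨_, h1, le_antisymm ?_ (minimumModulus_le B h1)⟩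
  rw [map_smul, norm_smul]
  simp only [norm_inv, Complex.norm_real, norm_norm]
  rwa [inv_mul_le_iff₀ h0, mul_comm]

theorem isMinimumAttaining_of_finiteDimensional [Nontrivial E] [FiniteDimensional ℂ E]
    (B : E →L[ℂ] F) : IsMinimumAttaining B := by
  have : ProperSpace E := FiniteDimensional.proper ℂ E
  obtain ⟨x0, hx0⟩ := exists_norm_eq E zero_le_one
  obtain ⟨x, hx, hmin⟩ := (isCompact_sphere (0 : E) 1).exists_isMinOn ⟨x0, by simpa using hx0⟩
    B.continuous.norm.continuousOn
  rw [mem_sphere_zero_iff_norm] at hx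
  refine ⟨x, hx, le_antisymm (le_csInf ⟨_, x, hx, rfl⟩ ?_) (minimumModulus_le B hx)⟩
  rintro _ ⟨y, hy, rfl⟩
  exact hmin (by simpa using hy)

variable [CompleteSpace E] [CompleteSpace F]

theorem inner_adjoint_comp_sub_smul_self (B : E →L[ℂ] F) (m : ℝ) (x : E) :
    RCLike.re (inner ℂ ((adjoint B ∘L B - ((m ^ 2 : ℝ) : ℂ) • ContinuousLinearMap.id ℂ E) x) x) =
      ‖B x‖ ^ 2 - m ^ 2 * ‖x‖ ^ 2 := by
  rw [apply_norm_sq_eq_inner_adjoint_left, ← inner_self_eq_norm_sq (𝕜 := ℂ) x]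
  simp only [sub_apply, smul_apply, inner_sub_left, inner_smul_left, map_sub]
  simp [← Complex.ofReal_pow]

theorem HasAlmostModulus.isMinimumAttaining [Nontrivial E] {B : E →L[ℂ] F}
    (h : HasAlmostModulus B) : IsMinimumAttaining B := by
  obtain ⟨β, hβ, ⟨W, hW, hle⟩, hge⟩ := h
  set m := minimumModulus B with hm
  have hm0 : 0 ≤ m := minimumModulus_nonneg B
  -- If `β ≤ m`, every nonzero vector of `Wᗮ` is a minimizer. If `m < β`, the positive operator `Q =
  -- B*B - m²` is almost bounded below, and a nonzero kernel vector of `Q` is a minimizer.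
  rcases le_or_gt β m with hβm | hβm
  · by_cases hx : ∃ x ∈ Wᗮ, x ≠ 0
    · obtain ⟨x, hx, hx0⟩ := hx
      exact isMinimumAttaining_of_norm_le B hx0
        ((hle x hx).trans (mul_le_mul_of_nonneg_right hβm (norm_nonneg x)))
    · push Not at hx
      have : FiniteDimensional ℂ (⊤ : Submodule ℂ E) :=
        finiteDimensional_of_inf_orthogonal_eq_bot W _ fun x _ => hx x
      have : FiniteDimensional ℂ E := Module.finite_def.2 (Module.Finite.iff_fg.1 this)
      exact isMinimumAttaining_of_finiteDimensional B
  obtain ⟨b, hmb, hbβ⟩ := exists_between hβm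
  obtain ⟨V, hV, hVge⟩ := hge b hbβ
  set Q := ContinuousLinearMap.adjoint B ∘L B - ((m ^ 2 : ℝ) : ℂ) • ContinuousLinearMap.id ℂ E
    with hQ
  have hform : ∀ x, RCLike.re (inner ℂ (Q x) x) = ‖B x‖ ^ 2 - m ^ 2 * ‖x‖ ^ 2 :=
    inner_adjoint_comp_sub_smul_self B m
  have hQge : AlmostGE Q (b ^ 2 - m ^ 2) := by
    refine ⟨V, hV, fun x hx => ?_⟩
    rcases (norm_nonneg x).eq_or_lt with h0 | h0
    · rw [← h0, mul_zero]; exact norm_nonneg _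
    · have h1 := hform x
      have h2 : RCLike.re (inner ℂ (Q x) x) ≤ ‖Q x‖ * ‖x‖ := re_inner_le_norm _ _
      have h3 := pow_le_pow_left₀ (mul_nonneg (hm0.trans hmb.le) h0.le) (hVge x hx) 2
      refine le_of_mul_le_mul_right ?_ h0
      nlinarith
  obtain ⟨c, hc, hbound⟩ := hQge.exists_bound_on_orthogonal_ker (by nlinarith)
  by_cases hker : ∃ x, Q x = 0 ∧ x ≠ 0
  · obtain ⟨x, hx, hx0⟩ := hker
    refine isMinimumAttaining_of_norm_le B hx0 ?_
    have h1 := hform x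
    rw [hx, inner_zero_left, map_zero] at h1
    exact abs_le_of_sq_le_sq' (by rw [mul_pow]; linarith) (by positivity) |>.2
  · exfalso
    push Not at hker
    have hker' : Q.ker = ⊥ := LinearMap.ker_eq_bot'.2 hker
    rw [hker', Submodule.bot_orthogonal_eq_top] at hbound
    -- positivity of `Q` upgrades the norm bound to a bound on its quadratic form
    have hQsymm : ∀ x y, inner ℂ (Q x) y = inner ℂ x (Q y) := by
      intro x y
      simp [hQ, adjoint_inner_left, adjoint_inner_right, mul_comm]
    have hQpos : ∀ x, 0 ≤ RCLike.re (inner ℂ (Q x) x) := by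
      intro x
      rw [hform, sub_nonneg, ← mul_pow]
      exact pow_le_pow_left₀ (by positivity) (minimumModulus_mul_norm_le B x) 2
    set t : ℝ := 1 / (‖Q‖ + 1) with ht
    have hQn : 0 ≤ ‖Q‖ := norm_nonneg Q
    have ht0 : 0 < t := by positivity
    have htQ : t * (‖Q‖ + 1) = 1 := by rw [ht]; field_simp
    -- Positivity of the form at `x - t Q x`; the `+ 1` in `t` keeps the denominator nonzero. With
    -- `c ‖x‖ ≤ ‖Q x‖` this would raise the minimum modulus above `m`.
    have hCS : ∀ x, t * ‖Q x‖ ^ 2 ≤ RCLike.re (inner ℂ (Q x) x) := by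
      intro x
      have h1 := hQpos (x - (t : ℂ) • Q x)
      have h2 : RCLike.re (inner ℂ (Q (x - (t : ℂ) • Q x)) (x - (t : ℂ) • Q x)) =
          RCLike.re (inner ℂ (Q x) x) - 2 * t * ‖Q x‖ ^ 2 +
            t ^ 2 * RCLike.re (inner ℂ (Q (Q x)) (Q x)) := by
        rw [map_sub, map_smul, inner_sub_left, inner_sub_right, inner_sub_right,
          inner_smul_left, inner_smul_right, inner_smul_left, inner_smul_right,
          hQsymm (Q x) x, ← inner_self_eq_norm_sq (𝕜 := ℂ) (Q x)]
        simp
        ring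
      have h3 : RCLike.re (inner ℂ (Q (Q x)) (Q x)) ≤ ‖Q‖ * ‖Q x‖ ^ 2 := by
        refine (re_inner_le_norm _ _).trans ?_
        have := mul_le_mul_of_nonneg_right (Q.le_opNorm (Q x)) (norm_nonneg (Q x))
        linarith
      rw [h2] at h1
      have h4 : t ^ 2 * RCLike.re (inner ℂ (Q (Q x)) (Q x)) ≤ t ^ 2 * (‖Q‖ * ‖Q x‖ ^ 2) :=
        mul_le_mul_of_nonneg_left h3 (by positivity)
      have h5 : t ^ 2 * (‖Q‖ * ‖Q x‖ ^ 2) = (t * (1 - t)) * ‖Q x‖ ^ 2 := by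
        have : t * ‖Q‖ = 1 - t := by linarith
        linear_combination t * ‖Q x‖ ^ 2 * this
      nlinarith [sq_nonneg (t * ‖Q x‖)]
    have hle' : √(m ^ 2 + t * c ^ 2) ≤ m := by
      refine le_minimumModulus B fun x => ?_
      refine abs_le_of_sq_le_sq' ?_ (norm_nonneg _) |>.2
      rw [mul_pow, Real.sq_sqrt (by positivity)]
      have h1 := hCS x
      rw [hform] at h1
      have h2 := pow_le_pow_left₀ (by positivity) (hbound x trivial) 2
      have h3 := mul_le_mul_of_nonneg_left h2 ht0.le
      linarith
    have := Real.sqrt_le_iff.1 hle'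
    nlinarith [mul_pos ht0 (pow_pos hc 2)]

theorem HasAlmostModulus.isAbsolutelyMinimumAttaining {B : E →L[ℂ] F}
    (h : HasAlmostModulus B) : IsAbsolutelyMinimumAttaining B := by
  intro M hM hM0
  have : CompleteSpace M := hM.completeSpace_coe
  have : Nontrivial M := (Submodule.nontrivial_iff_ne_bot).2 hM0
  -- Projecting `W` onto `M` gives a finite-dimensional exceptional subspace for the restriction to
  -- `M`.
  have hmem : ∀ (W : Submodule ℂ E), ∀ x ∈ (W.map (ContinuousLinearMap.adjoint M.subtypeL).toLinearMap)ᗮ,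
      (x : E) ∈ Wᗮ := by
    intro W x hx
    rw [Submodule.mem_orthogonal] at hx ⊢
    intro w hw
    have := hx _ (Submodule.mem_map_of_mem hw)
    exact (adjoint_inner_left M.subtypeL x w).symm.trans this
  obtain ⟨β, hβ, ⟨W, hW, hle⟩, hge⟩ := h
  refine HasAlmostModulus.isMinimumAttaining ⟨β, hβ, ⟨_, inferInstance, fun x hx =>
    hle x (hmem W x hx)⟩, fun b hb => ?_⟩
  obtain ⟨V, hV, hVge⟩ := hge b hb
  exact ⟨_, inferInstance, fun x hx => hVge x (hmem V x hx)⟩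

end MinimumAttaining

/-! ### AM implies almost modulus -/

section MinimizingSequence

variable {E F : Type*} [NormedAddCommGroup E] [InnerProductSpace ℂ E]
  [NormedAddCommGroup F] [InnerProductSpace ℂ F]

/-- An intermediate value argument for the Rayleigh-type quotient `‖B x‖ / ‖x‖`. -/
theorem exists_mem_norm_apply_eq_of_lt {B : E →L[ℂ] F} {V : Submodule ℂ E} {α γ : ℝ}
    (hαγ : α < γ) {x y : E} (hxV : x ∈ V) (hyV : y ∈ V) (hx : α * ‖x‖ < ‖B x‖)
    (hy : ‖B y‖ < γ * ‖y‖) :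
    ∃ e ∈ V, ‖e‖ = 1 ∧ α < ‖B e‖ ∧ ‖B e‖ < γ := by
  suffices h : ∃ e ∈ V, α * ‖e‖ < ‖B e‖ ∧ ‖B e‖ < γ * ‖e‖ by
    obtain ⟨e, heV, h1, h2⟩ := h
    have he0 : 0 < ‖e‖ := by
      by_contra hn
      have : e = 0 := norm_le_zero_iff.1 (not_lt.1 hn)
      simp [this] at h1
    refine ⟨(‖e‖⁻¹ : ℂ) • e, V.smul_mem _ heV, by simp [norm_smul, he0.ne'], ?_, ?_⟩ <;>
    · rw [map_smul, norm_smul]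
      simp only [norm_inv, Complex.norm_real, norm_norm]
      first
        | rwa [lt_inv_mul_iff₀ he0, mul_comm]
        | rwa [inv_mul_lt_iff₀ he0, mul_comm]
  by_cases hx' : ‖B x‖ < γ * ‖x‖
  · exact ⟨x, hxV, hx, hx'⟩
  by_cases hy' : α * ‖y‖ < ‖B y‖
  · exact ⟨y, hyV, hy', hy⟩
  rw [not_lt] at hx' hy'
  have hx0 : 0 < ‖x‖ := by
    by_contra hn
    have : x = 0 := norm_le_zero_iff.1 (not_lt.1 hn)
    simp [this] at hx
  have hy0 : 0 < ‖y‖ := by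
    by_contra hn
    have : y = 0 := norm_le_zero_iff.1 (not_lt.1 hn)
    simp [this] at hy
  set δ := (α + γ) / 2 with hδ
  let p : ℝ → E := fun t => ((1 - t : ℝ) : ℂ) • x + (t : ℂ) • y
  have hp : Continuous p := by fun_prop
  have hg : Continuous fun t => ‖B (p t)‖ - δ * ‖p t‖ := by fun_prop
  have hp0 : p 0 = x := by simp [p]
  have hp1 : p 1 = y := by simp [p]
  obtain ⟨t, ⟨ht0, ht1⟩, ht⟩ := intermediate_value_Icc' (zero_le_one' ℝ) hg.continuousOn
    (show (0 : ℝ) ∈ Set.Icc _ _ by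
      rw [hp0, hp1]
      constructor <;> nlinarith)
  have ht : ‖B (p t)‖ = δ * ‖p t‖ := sub_eq_zero.1 ht
  -- If the segment met `0`, `x` and `y` would be proportional with equal quotients, but one is at
  -- least `γ` and the other at most `α`.
  have hpt : 0 < ‖p t‖ := by
    by_contra hn
    have h0 : p t = 0 := norm_le_zero_iff.1 (not_lt.1 hn)
    have h1 : ((1 - t : ℝ) : ℂ) • x = -((t : ℂ) • y) := eq_neg_of_add_eq_zero_left h0
    have h2 : (1 - t) * ‖x‖ = t * ‖y‖ := by
      have := congrArg norm h1
      rwa [norm_neg, norm_smul, norm_smul, Complex.norm_of_nonneg (sub_nonneg.2 ht1),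
        Complex.norm_of_nonneg ht0] at this
    have h3 : (1 - t) * ‖B x‖ = t * ‖B y‖ := by
      have := congrArg (fun v => ‖B v‖) h1
      simp only [map_neg, map_smul] at this
      rwa [norm_neg, norm_smul, norm_smul, Complex.norm_of_nonneg (sub_nonneg.2 ht1),
        Complex.norm_of_nonneg ht0] at this
    have h4 := mul_le_mul_of_nonneg_left hx' (sub_nonneg.2 ht1)
    have h5 := mul_le_mul_of_nonneg_left hy' ht0
    have h6 : γ * (t * ‖y‖) ≤ α * (t * ‖y‖) := by
      have h6 : (1 - t) * (γ * ‖x‖) ≤ t * (α * ‖y‖) := by linarith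
      linear_combination h6 - γ * h2
    have h7 : t * ‖y‖ ≤ 0 := by nlinarith
    have h8 : t = 0 := by nlinarith
    rw [h8] at h2
    linarith
  refine ⟨p t, V.add_mem (V.smul_mem _ hxV) (V.smul_mem _ hyV), ?_, ?_⟩ <;>
  · rw [ht]
    exact mul_lt_mul_of_pos_right (by linarith) hpt

/-- Pythagoras for an infinite orthogonal expansion. -/
theorem hasSum_norm_sq_of_pairwise_orthogonal {f : ℕ → E}
    (hf : Pairwise fun m n => inner ℂ (f m) (f n) = 0) {c : ℕ → ℂ} {y : E}
    (h : HasSum (fun n => c n • f n) y) :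
    HasSum (fun n => ‖c n‖ ^ 2 * ‖f n‖ ^ 2) (‖y‖ ^ 2) := by
  have hinner : ∀ n, inner ℂ (f n) y = c n * (‖f n‖ : ℂ) ^ 2 := by
    intro n
    have h1 := h.mapL (innerSL ℂ (f n))
    have h2 : HasSum (fun k => innerSL ℂ (f n) (c k • f k)) (innerSL ℂ (f n) (c n • f n)) := by
      refine hasSum_single n fun k hk => ?_
      rw [innerSL_apply_apply, inner_smul_right, hf hk.symm, mul_zero]
    have h3 := h1.unique h2
    rw [innerSL_apply_apply, innerSL_apply_apply, inner_smul_right,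
      inner_self_eq_norm_sq_to_K] at h3
    exact h3
  have h1 := (h.mapL (innerSL ℂ y)).mapL Complex.reCLM
  convert h1 using 1
  · funext n
    rw [innerSL_apply_apply, inner_smul_right, ← inner_conj_symm y, hinner n, map_mul (starRingEnd ℂ),
      ← mul_assoc, Complex.mul_conj, map_pow, Complex.conj_ofReal, Complex.normSq_eq_norm_sq,
      ← Complex.ofReal_pow, ← Complex.ofReal_mul]
    rfl
  · rw [innerSL_apply_apply]
    exact (inner_self_eq_norm_sq (𝕜 := ℂ) y).symm

variable [CompleteSpace E]

/-- An operator that sends an orthonormal sequence to an orthogonal one is strictly larger than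
`β` on the closed span of the sequence if it is so on every member of it. -/
theorem lt_norm_apply_of_mem_closure_span {B : E →L[ℂ] F} {β : ℝ} (hβ : 0 ≤ β) {e : ℕ → E}
    (he : Orthonormal ℂ e) (hB : Pairwise fun m n => inner ℂ (B (e m)) (B (e n)) = 0)
    (hlt : ∀ n, β < ‖B (e n)‖) {x : E}
    (hx : x ∈ (Submodule.span ℂ (Set.range e)).topologicalClosure) (hx1 : ‖x‖ = 1) :
    β < ‖B x‖ := by
  set M := (Submodule.span ℂ (Set.range e)).topologicalClosure with hM
  have hMc : CompleteSpace M :=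
    (Submodule.isClosed_topologicalClosure _).completeSpace_coe
  have heM : ∀ n, e n ∈ M := fun n =>
    Submodule.le_topologicalClosure _ (Submodule.subset_span ⟨n, rfl⟩)
  let e' : ℕ → M := fun n => ⟨e n, heM n⟩
  have he' : Orthonormal ℂ e' := by
    rw [orthonormal_iff_ite] at he ⊢
    exact fun i j => he i j
  have hbot : (Submodule.span ℂ (Set.range e'))ᗮ = ⊥ := by
    rw [eq_bot_iff]
    intro y hy
    have h1 : (y : E) ∈ (Submodule.span ℂ (Set.range e))ᗮ := by
      have hle : Submodule.span ℂ (Set.range e) ≤ (Submodule.span ℂ {(y : E)})ᗮ := by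
        rw [Submodule.span_le]
        rintro _ ⟨n, rfl⟩
        rw [SetLike.mem_coe, Submodule.mem_orthogonal_singleton_iff_inner_left]
        exact (Submodule.mem_orthogonal _ _).1 hy _ (Submodule.subset_span ⟨n, rfl⟩)
      rw [Submodule.mem_orthogonal]
      exact fun u hu => Submodule.mem_orthogonal_singleton_iff_inner_left.1 (hle hu)
    rw [← Submodule.orthogonal_closure] at h1
    have h2 := Submodule.inner_right_of_mem_orthogonal y.2 h1
    rw [inner_self_eq_zero] at h2
    exact Subtype.ext h2
  let b : HilbertBasis ℕ ℂ M := HilbertBasis.mkOfOrthogonalEqBot he' hbot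
  have hb : ∀ n, ((b n : M) : E) = e n := fun n => by
    simp [b, HilbertBasis.coe_mkOfOrthogonalEqBot, e']
  set c : ℕ → ℂ := fun n => b.repr ⟨x, hx⟩ n with hc
  have hsum : HasSum (fun n => c n • e n) x := by
    have := (b.hasSum_repr ⟨x, hx⟩).mapL M.subtypeL
    simpa [hb] using this
  have hBsum : HasSum (fun n => ‖c n‖ ^ 2 * ‖B (e n)‖ ^ 2) (‖B x‖ ^ 2) :=
    hasSum_norm_sq_of_pairwise_orthogonal hB (by simpa using hsum.mapL B)
  have hxsum : HasSum (fun n => ‖c n‖ ^ 2 * β ^ 2) (β ^ 2) := by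
    have := (hasSum_norm_sq_of_pairwise_orthogonal (fun m n hmn => he.2 hmn) hsum).mul_right (β ^ 2)
    simpa [he.1, hx1] using this
  have hc0 : ∃ n, c n ≠ 0 := by
    by_contra! h0
    simp only [h0, zero_smul] at hsum
    have := hsum.unique hasSum_zero
    simp [this] at hx1
  obtain ⟨n, hn⟩ := hc0
  have hlt' : β ^ 2 < ‖B x‖ ^ 2 := by
    refine hasSum_lt (i := n) (fun k => ?_) ?_ hxsum hBsum
    · exact mul_le_mul_of_nonneg_left (pow_le_pow_left₀ hβ (hlt k).le 2) (by positivity)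
    · exact mul_lt_mul_of_pos_left (pow_lt_pow_left₀ (hlt n) hβ two_ne_zero)
        (by have := norm_pos_iff.2 hn; positivity)
  exact lt_of_pow_lt_pow_left₀ 2 (norm_nonneg _) hlt'

variable [CompleteSpace F]

/-- Take `β` to be the supremum of the almost lower bounds. If `β` is not an almost upper bound,
there are orthonormal `e n` with orthogonal images and `‖B (e n)‖` decreasing to `β` from strictly
above. On their closed span the infimum is `β` and is not attained. -/
theorem IsAbsolutelyMinimumAttaining.hasAlmostModulus {B : E →L[ℂ] F}
    (h : IsAbsolutelyMinimumAttaining B) : HasAlmostModulus B := by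
  by_cases hfin : FiniteDimensional ℂ E
  · refine ⟨0, le_rfl, ⟨⊤, inferInstance, fun x hx => ?_⟩, fun b hb => almostGE_of_nonpos B hb.le⟩
    rw [Submodule.top_orthogonal_eq_bot, Submodule.mem_bot] at hx
    simp [hx]
  have hbdd : BddAbove {b : ℝ | AlmostGE B b} := by
    refine ⟨‖B‖, fun b ⟨W, hW, hb⟩ => ?_⟩
    have : ∃ x ∈ Wᗮ, x ≠ 0 := by
      by_contra! hx
      have : FiniteDimensional ℂ (⊤ : Submodule ℂ E) :=
        finiteDimensional_of_inf_orthogonal_eq_bot W _ fun x _ => hx x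
      exact hfin (Module.finite_def.2 (Module.Finite.iff_fg.1 this))
    obtain ⟨x, hx, hx0⟩ := this
    exact le_of_mul_le_mul_right ((hb x hx).trans (B.le_opNorm x)) (norm_pos_iff.2 hx0)
  set β := sSup {b : ℝ | AlmostGE B b} with hβ
  have hβ0 : 0 ≤ β := le_csSup hbdd (almostGE_of_nonpos B le_rfl)
  have hge : ∀ b < β, AlmostGE B b := by
    intro b hb
    obtain ⟨c, hc, hbc⟩ := exists_lt_of_lt_csSup ⟨0, almostGE_of_nonpos B le_rfl⟩ hb
    exact hc.mono hbc.le
  refine ⟨β, hβ0, ?_, hge⟩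
  by_contra hle
  have hstep : ∀ W : Submodule ℂ E, FiniteDimensional ℂ W → ∀ ε > 0,
      ∃ e ∈ Wᗮ, ‖e‖ = 1 ∧ β < ‖B e‖ ∧ ‖B e‖ < β + ε := by
    intro W hW ε hε
    have hx : ∃ x ∈ Wᗮ, β * ‖x‖ < ‖B x‖ := by
      by_contra! hx
      exact hle ⟨W, hW, hx⟩
    have hy : ∃ y ∈ Wᗮ, ‖B y‖ < (β + ε) * ‖y‖ := by
      by_contra! hy
      have : β + ε ≤ β := le_csSup hbdd ⟨W, hW, hy⟩
      linarith
    obtain ⟨x, hxW, hx⟩ := hx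
    obtain ⟨y, hyW, hy⟩ := hy
    exact exists_mem_norm_apply_eq_of_lt (by linarith) hxW hyW hx hy
  obtain ⟨e, he, hr⟩ := exists_seq_of_forall_finset_exists
    (fun x : E => ‖x‖ = 1 ∧ β < ‖B x‖)
    (fun x y => inner ℂ x y = 0 ∧ inner ℂ (B x) (B y) = 0 ∧ ‖B y‖ - β ≤ (‖B x‖ - β) / 2) (by
      intro s hs
      have hε : ∃ ε > (0 : ℝ), ∀ x ∈ s, ε ≤ (‖B x‖ - β) / 2 := by
        have : ∀ᶠ ε in 𝓝[>] (0 : ℝ), ∀ x ∈ s, ε ≤ (‖B x‖ - β) / 2 := by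
          rw [eventually_all_finset]
          intro x hx
          have : 0 < (‖B x‖ - β) / 2 := by linarith [(hs x hx).2]
          exact nhdsWithin_le_nhds (eventually_le_nhds this)
        obtain ⟨ε, h1, h2⟩ := (this.and self_mem_nhdsWithin).exists
        exact ⟨ε, h2, h1⟩
      obtain ⟨ε, hε0, hε⟩ := hε
      have hfd : FiniteDimensional ℂ (Submodule.span ℂ (s : Set E)) :=
        FiniteDimensional.span_finset ℂ s
      -- Orthogonality to `B*B x` is what makes `B y` orthogonal to `B x`.
      obtain ⟨y, hyW, hy1, hy2, hy3⟩ := hstep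
        (Submodule.span ℂ (s : Set E) ⊔
          (Submodule.span ℂ (s : Set E)).map (adjoint B ∘L B).toLinearMap)
        inferInstance ε hε0
      refine ⟨y, ⟨hy1, hy2⟩, fun x hx => ⟨?_, ?_, by linarith [hε x hx]⟩⟩
      · exact (Submodule.mem_orthogonal _ _).1 (Submodule.orthogonal_le le_sup_left hyW) x
          (Submodule.subset_span (Finset.mem_coe.2 hx))
      · have hBBx : adjoint B (B x) ∈
            (Submodule.span ℂ (s : Set E)).map (adjoint B ∘L B).toLinearMap :=
          ⟨x, Submodule.subset_span (Finset.mem_coe.2 hx), rfl⟩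
        exact (adjoint_inner_left B y (B x)).symm.trans
          ((Submodule.mem_orthogonal _ _).1 (Submodule.orthogonal_le le_sup_right hyW) _ hBBx))
  have hsymm : ∀ {m n}, m ≠ n → inner ℂ (e m) (e n) = 0 ∧ inner ℂ (B (e m)) (B (e n)) = 0 := by
    intro m n hmn
    rcases hmn.lt_or_gt with hlt | hlt
    · exact ⟨(hr m n hlt).1, (hr m n hlt).2.1⟩
    · exact ⟨inner_eq_zero_symm.1 (hr n m hlt).1, inner_eq_zero_symm.1 (hr n m hlt).2.1⟩
  have horth : Orthonormal ℂ e := ⟨fun n => (he n).1, fun m n hmn => (hsymm hmn).1⟩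
  have hdecay : ∀ n, ‖B (e n)‖ - β ≤ (‖B (e 0)‖ - β) * (1 / 2) ^ n := by
    intro n
    induction n with
    | zero => simp
    | succ n ih =>
      have := (hr n (n + 1) (Nat.lt_succ_self n)).2.2
      rw [pow_succ]
      linarith
  set M := (Submodule.span ℂ (Set.range e)).topologicalClosure with hM
  have heM : ∀ n, e n ∈ M := fun n =>
    Submodule.le_topologicalClosure _ (Submodule.subset_span ⟨n, rfl⟩)
  have hM0 : M ≠ ⊥ := by
    intro hbot
    have h0 := heM 0
    rw [hbot, Submodule.mem_bot] at h0
    have := (he 0).1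
    simp [h0] at this
  obtain ⟨x, hx1, hx⟩ := h M (Submodule.isClosed_topologicalClosure _) hM0
  have hlt : β < ‖B x‖ := lt_norm_apply_of_mem_closure_span hβ0 horth
    (fun m n hmn => (hsymm hmn).2) (fun n => (he n).2) x.2 hx1
  have hmin : ∀ n, ‖B x‖ ≤ ‖B (e n)‖ := fun n =>
    hx.trans_le (minimumModulus_le (B ∘L M.subtypeL) (x := ⟨e n, heM n⟩) (he n).1)
  have hlim : Tendsto (fun n : ℕ => β + (‖B (e 0)‖ - β) * (1 / 2 : ℝ) ^ n) atTop (𝓝 β) := by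
    have := (tendsto_pow_atTop_nhds_zero_of_lt_one (r := (1 / 2 : ℝ)) (by norm_num)
      (by norm_num)).const_mul (‖B (e 0)‖ - β)
    simpa using this.const_add β
  have : ‖B x‖ ≤ β := ge_of_tendsto' hlim fun n => by linarith [hmin n, hdecay n]
  linarith

end MinimizingSequence

theorem isAbsolutelyMinimumAttaining_iff_hasAlmostModulus {E F : Type*} [NormedAddCommGroup E]
    [InnerProductSpace ℂ E] [NormedAddCommGroup F] [InnerProductSpace ℂ F] [CompleteSpace E]
    [CompleteSpace F] (B : E →L[ℂ] F) :
    IsAbsolutelyMinimumAttaining B ↔ HasAlmostModulus B :=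
  ⟨IsAbsolutelyMinimumAttaining.hasAlmostModulus, HasAlmostModulus.isAbsolutelyMinimumAttaining⟩

theorem theorem3p10 {H : Type*} [NormedAddCommGroup H] [InnerProductSpace ℂ H] [CompleteSpace H]
    (T : H →L[ℂ] H)
    (hT : essentialSpectrum (ContinuousLinearMap.adjoint T ∘L T) =
      essentialSpectrum (T ∘L ContinuousLinearMap.adjoint T)) :
    (IsAbsolutelyMinimumAttaining (T ∘L ContinuousLinearMap.adjoint T) ↔
      IsAbsolutelyMinimumAttaining (ContinuousLinearMap.adjoint T ∘L T)) ∧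
    (IsAbsolutelyMinimumAttaining T ↔
      IsAbsolutelyMinimumAttaining (ContinuousLinearMap.adjoint T)) := by
  have hiff : HasAlmostModulus T ↔ HasAlmostModulus (ContinuousLinearMap.adjoint T) := by
    refine ⟨fun h => h.adjoint (by rw [hT]; exact id), fun h => ?_⟩
    have := h.adjoint (by rw [adjoint_adjoint, hT]; exact id)
    rwa [adjoint_adjoint] at this
  have h1 := hasAlmostModulus_adjoint_comp_self_iff (ContinuousLinearMap.adjoint T)
  rw [adjoint_adjoint] at h1
  simp only [isAbsolutelyMinimumAttaining_iff_hasAlmostModulus]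
  exact ⟨h1.trans (hiff.symm.trans (hasAlmostModulus_adjoint_comp_self_iff T).symm), hiff⟩
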